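/- Fix $\tfrac12<\alpha<1$ and $C\in\mathbb R$, and put $\beta:=2\alpha+1$, so that $2<\beta<3$ ($\beta$ is the power-law exponent of the model). The hyperbolic random graph $\mathcal G(n,\alpha,C)$ is defined as follows. Let $R:=2\ln n+C$. Draw $n$ points $v$ of the hyperbolic plane independently, in polar coordinates $(r_v,\varphi_v)$ with $r_v$ the hyperbolic distance to the origin, where $\varphi_v$ is uniform on $[0,2\pi)$ and, independently, $r_v\in[0,R]$ has density $\rho(r)=\frac{\alpha\sinh(\alpha r)}{\cosh(\alpha R)-1}$; connect two distinct points $u,v$ if and only if their hyperbolic distance $\cosh^{-1}\bigl(\cosh r_u\cosh r_v-\sinh r_u\sinh r_v\cos(\varphi_u-\varphi_v)\bigr)$ is at most $R$. Then there are constants $K,M>0$, depending only on $\alpha$ and $C$, such that for all sufficiently large $n$: (i) with probability at least $1-Mn^{-3/2}$, the second largest connected component of $\mathcal G(n,\alpha,C)$ has at most $K(\log n)^{2/(3-\beta)}$ vertices (it is counted as having $0$ vertices if the graph is connected); (ii) if the disc of radius $R$ is divided into the $n$ sectors $\{2\pi i/n\le\varphi<2\pi(i+1)/n\}$, $0\le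 i<n$, then with probability at least $1-Mn^{-3/2}$ every connected component that spans at least $K(\log n)^{1/(1-\alpha)}$ sectors is connected to the center, i.e. contains a vertex $v$ with $r_v\le R/2$. Here the number of sectors spanned by a component is the least length of a cyclic run of consecutive sectors containing all its vertices. -/

import Mathlib

noncomputable section

namespace HyperbolicRandomGraph

open MeasureTheory

/-- The radius `R = 2 ln n + C` of the disc. -/
def radius (n : ℕ) (C : ℝ) : ℝ := 2 * Real.log n + C

/-- The small relative angle `Δφ ∈ [0, π]` between two directions `φ`, `ψ`. -/
def relAngle (φ ψ : ℝ) : ℝ := Real.arccos (Real.cos (φ - ψ))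

/-- The distance in the hyperbolic plane of two points given in native polar coordinates
`p = (r, φ)`, where `r` is the hyperbolic distance to the origin and `φ` the angle. -/
def hdist (p q : ℝ × ℝ) : ℝ :=
  Real.arcosh (Real.cosh p.1 * Real.cosh q.1
    - Real.sinh p.1 * Real.sinh q.1 * Real.cos (relAngle p.2 q.2))

theorem hdist_comm (p q : ℝ × ℝ) : hdist p q = hdist q p := by
  unfold hdist relAngle
  rw [← Real.cos_neg (p.2 - q.2), neg_sub, mul_comm (Real.cosh p.1), mul_comm (Real.sinh p.1)]

/-- The radial law: density `α sinh (α r) / (cosh (α R) - 1)` on `[0, R]`. -/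
def radialLaw (α R : ℝ) : Measure ℝ :=
  (volume.restrict (Set.Icc 0 R)).withDensity fun r =>
    ENNReal.ofReal (α * Real.sinh (α * r) / (Real.cosh (α * R) - 1))

/-- The angular law: uniform on `[0, 2π)`. -/
def angularLaw : Measure ℝ :=
  ProbabilityTheory.cond volume (Set.Ico 0 (2 * Real.pi))

/-- The law of a single random point `(r, φ)` of the disc of radius `R`. -/
def pointLaw (α R : ℝ) : Measure (ℝ × ℝ) := (radialLaw α R).prod angularLaw

/-- The joint law of `n` independent random points of the disc of radius `2 ln n + C`. -/
def sampleLaw (n : ℕ) (α C : ℝ) : Measure (Fin n → ℝ × ℝ) :=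
  Measure.pi fun _ => pointLaw α (radius n C)

/-- The geometric graph on the points `x`: distinct vertices are adjacent iff their hyperbolic
distance is at most `R`. For `x` distributed as `sampleLaw n α C` and `R = radius n C` this is
the hyperbolic random graph. -/
def graph {n : ℕ} (R : ℝ) (x : Fin n → ℝ × ℝ) : SimpleGraph (Fin n) where
  Adj u v := u ≠ v ∧ hdist (x u) (x v) ≤ R
  symm := ⟨fun u v h => ⟨h.1.symm, hdist_comm (x u) (x v) ▸ h.2⟩⟩
  loopless := ⟨fun _ h => h.1 rfl⟩

open Classical in
/-- The number of vertices of the second largest connected component (components counted with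
multiplicity, so that it equals the largest size if two components attain it; it is `0` if
there is at most one component). -/
def secondLargest {V : Type*} [Fintype V] (G : SimpleGraph V) : ℕ :=
  (Finset.univ : Finset G.ConnectedComponent).offDiag.sup
    fun p => min p.1.supp.ncard p.2.supp.ncard

/-- The disc is cut into `n` sectors `{(r, φ) | 2π i / n ≤ φ < 2π (i + 1) / n}`, `0 ≤ i < n`;
this is the index of the sector of `p`. -/
def sectorIndex (n : ℕ) (p : ℝ × ℝ) : ℕ := ⌊n * p.2 / (2 * Real.pi)⌋₊

/-- The number of sectors spanned by a set `S` of vertices: the smallest length `l` of a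
(cyclic) run `s, s + 1, …, s + l - 1` of consecutive sectors that contains all points of `S`. -/
def sectorSpan {n : ℕ} (x : Fin n → ℝ × ℝ) (S : Set (Fin n)) : ℕ :=
  sInf {l | ∃ s : ℕ, ∀ v ∈ S, ∃ j < l, sectorIndex n (x v) = (s + j) % n}

end HyperbolicRandomGraph

end

noncomputable section

namespace HyperbolicRandomGraph

open MeasureTheory Real

/-! ### Adjacency in polar coordinates -/

/-! A vertex has depth at least t if its radius is at most R - t. For each integer m from m₀ ≈ (log
log n)/(1-α) + const up to m₁ ≈ R/2, cut the disc into about 20·exp(R/2 - m) equal sectors. The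
expected number of points of depth at least m in one of them is of order exp((1-α)m). From m₀ on
this is at least 4 log n, so by a union bound it is likely that none of these cells is empty
(`sampleLaw_not_good_le`, `exists_good`). A vertex of depth m is adjacent to any vertex of depth m +
1 in the same level-(m+1) sector (`hdist_le_of_depth`); climbing level by level joins every vertex
of depth at least m₀ to the center (`central_of_depth`).

Vertices joined to the center act as barriers: an edge passing over the angle of one is itself
joined to the center (`central_of_between`). Every level-m₀ sector contains a barrier, so a
component away from the center is trapped within neighbouring sectors. Their total angle is
O(exp(m₀)/n), which amounts to O((log n)^(1/(1-α))) of the n sectors, and by a Chernoff bound they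
contain as few points. Vertices of radius at most R/2 are pairwise adjacent, so at most one
component reaches the center and the second largest is no larger than a trapped one. -/

theorem hdist_le_iff {R : ℝ} (hR : 0 ≤ R) {p q : ℝ × ℝ} (hp : 0 ≤ p.1) (hq : 0 ≤ q.1) :
    hdist p q ≤ R ↔
      cosh p.1 * cosh q.1 - sinh p.1 * sinh q.1 * cos (p.2 - q.2) ≤ cosh R := by
  unfold hdist relAngle
  rw [cos_arccos (neg_one_le_cos _) (cos_le_one _)]
  have h1 : 1 ≤ cosh p.1 * cosh q.1 - sinh p.1 * sinh q.1 * cos (p.2 - q.2) := by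
    have h2 := one_le_cosh (p.1 - q.1)
    rw [cosh_sub] at h2
    have h3 := mul_le_mul_of_nonneg_left (cos_le_one (p.2 - q.2))
      (mul_nonneg (sinh_nonneg_iff.2 hp) (sinh_nonneg_iff.2 hq))
    linarith
  conv_lhs => rw [← arcosh_cosh hR]
  exact arcosh_le_arcosh (by linarith) (cosh_pos R)

theorem hdist_le_of_add_le {R : ℝ} {p q : ℝ × ℝ} (hp : 0 ≤ p.1) (hq : 0 ≤ q.1)
    (h : p.1 + q.1 ≤ R) : hdist p q ≤ R := by
  have hR : 0 ≤ R := by linarith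
  rw [hdist_le_iff hR hp hq]
  have h2 : cosh (p.1 + q.1) ≤ cosh R := by
    rw [cosh_le_cosh, abs_of_nonneg (by linarith), abs_of_nonneg hR]; exact h
  rw [cosh_add] at h2
  have h3 := mul_le_mul_of_nonneg_left (neg_one_le_cos (p.2 - q.2))
    (mul_nonneg (sinh_nonneg_iff.2 hp) (sinh_nonneg_iff.2 hq))
  linarith

theorem sinh_add_sinh_le {a b : ℝ} (ha : 0 ≤ a) (hb : 0 ≤ b) :
    sinh a + sinh b ≤ sinh (a + b) := by
  rw [sinh_add]
  nlinarith [one_le_cosh a, one_le_cosh b, sinh_nonneg_iff.2 ha, sinh_nonneg_iff.2 hb]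

/-- Adjacency is monotone in the radius and in the angle of the second point. -/
theorem hdist_le_of_le {R : ℝ} {p q w : ℝ × ℝ} (hp : 0 ≤ p.1) (hpR : p.1 ≤ R)
    (hw : 0 ≤ w.1) (hwq : w.1 ≤ q.1) (hcos : cos (p.2 - q.2) ≤ cos (p.2 - w.2))
    (h : hdist p q ≤ R) : hdist p w ≤ R := by
  have hR : 0 ≤ R := hp.trans hpR
  rw [hdist_le_iff hR hp hw]
  rw [hdist_le_iff hR hp (hw.trans hwq)] at h
  have hpc : cosh p.1 ≤ cosh R := by
    rw [cosh_le_cosh, abs_of_nonneg hp, abs_of_nonneg hR]; exact hpR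
  have hsp := sinh_nonneg_iff.2 hp
  have hsw := sinh_nonneg_iff.2 hw
  have hsub := sinh_add_sinh_le (sub_nonneg.2 hwq) hw
  rw [sub_add_cancel] at hsub
  have hsd := sinh_nonneg_iff.2 (sub_nonneg.2 hwq)
  rcases (hw.trans hwq).eq_or_lt with h0 | h0
  · have : w.1 = 0 := le_antisymm (hwq.trans h0.symm.le) hw
    rw [this]; simpa using hpc
  have hsq := sinh_pos_iff.2 h0
  set κ := cos (p.2 - q.2)
  -- Convexity of the ball of radius R around `p`: it contains the origin (as `p.1 ≤ R`) and `q`,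
  -- hence the segment joining them. The identity interpolates between the values at radius 0 and at
  -- radius `q.1`.
  have key : (cosh p.1 * cosh w.1 - sinh p.1 * sinh w.1 * κ) * sinh q.1 =
      cosh p.1 * sinh (q.1 - w.1) +
        (cosh p.1 * cosh q.1 - sinh p.1 * sinh q.1 * κ) * sinh w.1 := by
    rw [sinh_sub]; ring
  have hle : cosh p.1 * cosh w.1 - sinh p.1 * sinh w.1 * κ ≤ cosh R := by
    refine le_of_mul_le_mul_right ?_ hsq
    rw [key]
    have h1 := mul_le_mul_of_nonneg_right hpc hsd
    have h2 := mul_le_mul_of_nonneg_right h hsw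
    have h3 := mul_le_mul_of_nonneg_left hsub (cosh_pos R).le
    linarith
  have := mul_le_mul_of_nonneg_left hcos (mul_nonneg hsp hsw)
  linarith

/-- Two points of depth at least `t` and `t + 1` whose angles differ by at most
`exp (t - R / 2)` are adjacent. -/
theorem hdist_le_of_depth {R t : ℝ} {p q : ℝ × ℝ} (hR : 2 ≤ R) (ht : 1 ≤ t)
    (hp : 0 ≤ p.1) (hq : 0 ≤ q.1) (hpt : p.1 ≤ R - t) (hqt : q.1 ≤ R - (t + 1))
    (hang : |p.2 - q.2| ≤ exp (t - R / 2)) : hdist p q ≤ R := by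
  rw [hdist_le_iff (by linarith) hp hq]
  -- The cosh of the distance is cosh(p.1 - q.1) + sinh p.1 · sinh q.1 · (1 - cos). The two terms
  -- are bounded by cosh(R - 1) and exp(R - 1)/8; the powers of exp t cancel in the second.
  have h1 : cosh (p.1 - q.1) ≤ cosh (R - 1) := by
    rw [cosh_le_cosh, abs_of_nonneg (by linarith : 0 ≤ R - 1)]
    exact abs_le.2 ⟨by linarith, by linarith⟩
  have hs : ∀ {r : ℝ}, sinh r ≤ exp r / 2 := fun {r} => by
    rw [sinh_eq]; linarith [exp_pos (-r)]
  have h2 : sinh p.1 * sinh q.1 ≤ exp (R - t) / 2 * (exp (R - (t + 1)) / 2) :=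
    mul_le_mul (hs.trans (by gcongr)) (hs.trans (by gcongr))
      (sinh_nonneg_iff.2 hq) (by positivity)
  have h3 : 1 - cos (p.2 - q.2) ≤ exp (t - R / 2) ^ 2 / 2 := by
    have h4 := one_sub_sq_div_two_le_cos (x := p.2 - q.2)
    have h5 : (p.2 - q.2) ^ 2 ≤ exp (t - R / 2) ^ 2 := by
      rw [← sq_abs]; gcongr
    linarith
  have h4 : sinh p.1 * sinh q.1 * (1 - cos (p.2 - q.2)) ≤ exp (R - 1) / 8 := by
    calc _ ≤ exp (R - t) / 2 * (exp (R - (t + 1)) / 2) * (exp (t - R / 2) ^ 2 / 2) :=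
          mul_le_mul h2 h3 (by linarith [cos_le_one (p.2 - q.2)]) (by positivity)
      _ = exp (R - t) * exp (R - (t + 1)) * exp (t - R / 2) ^ 2 / 8 := by ring
      _ = exp (R - 1) / 8 := by
          rw [sq, ← exp_add, ← exp_add, ← exp_add]; congr 2; ring
  have h5 : cosh (R - 1) + exp (R - 1) / 8 ≤ cosh R := by
    rw [cosh_eq, cosh_eq]
    have e1 : exp R = exp (R - 1) * exp 1 := by rw [← exp_add]; congr 1; ring
    have e2 : exp (-(R - 1)) ≤ exp 0 := exp_le_exp.2 (by linarith)
    have e3 : 2 ≤ exp (R - 1) := by linarith [add_one_le_exp (R - 1)]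
    have e4 := exp_one_gt_d9
    rw [exp_zero] at e2
    nlinarith [exp_pos (-R)]
  rw [cosh_sub] at h1
  linarith

/-! ### Lifted angles and crossing edges -/

/-- `a` is a representative modulo `2π` of the angle `φ`. -/
def IsLift (φ a : ℝ) : Prop := ∃ k : ℤ, a = φ + k * (2 * π)

theorem IsLift.self (φ : ℝ) : IsLift φ φ := ⟨0, by simp⟩

theorem IsLift.cos_sub {φ ψ a b : ℝ} (ha : IsLift φ a) (hb : IsLift ψ b) :
    cos (φ - ψ) = cos (a - b) := by
  obtain ⟨k, rfl⟩ := ha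
  obtain ⟨l, rfl⟩ := hb
  rw [← cos_add_int_mul_two_pi (φ - ψ) (k - l)]
  congr 1; push_cast; ring

/-- Unwraps a walk onto the real line edge by edge, with steps of at most π. There betweenness is
the linear order, and cos decreases in the absolute angle difference. -/
theorem IsLift.exists_near {ψ : ℝ} (a : ℝ) : ∃ b, IsLift ψ b ∧ |a - b| ≤ π := by
  refine ⟨ψ + round ((a - ψ) / (2 * π)) * (2 * π), ⟨_, rfl⟩, ?_⟩
  have h := abs_sub_round ((a - ψ) / (2 * π))
  have hpi := two_pi_pos
  have : a - (ψ + round ((a - ψ) / (2 * π)) * (2 * π)) =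
      ((a - ψ) / (2 * π) - round ((a - ψ) / (2 * π))) * (2 * π) := by
    field_simp; ring
  rw [this, abs_mul, abs_of_pos hpi]
  nlinarith

theorem cos_le_cos_of_abs_le {s t : ℝ} (h : |s| ≤ |t|) (ht : |t| ≤ π) : cos t ≤ cos s := by
  rw [← cos_abs t, ← cos_abs s]
  exact cos_le_cos_of_nonneg_of_le_pi (abs_nonneg s) ht h

section Graph

variable {n : ℕ} {R : ℝ} {x : Fin n → ℝ × ℝ}

/-- If the angle of `w` is between the angles of adjacent `u`, `v` and `w` is not further out
than both of them, then `w` is in the component of `u` and `v`. -/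
theorem reachable_of_between (hx : ∀ v, 0 ≤ (x v).1 ∧ (x v).1 ≤ R) {u v w : Fin n} {a b c : ℝ}
    (ha : IsLift (x u).2 a) (hb : IsLift (x v).2 b) (hc : IsLift (x w).2 c)
    (hac : |a - c| ≤ |a - b|) (hbc : |b - c| ≤ |a - b|) (hab : |a - b| ≤ π)
    (huv : (graph R x).Adj u v) (hr : (x w).1 ≤ max (x u).1 (x v).1) :
    (graph R x).Reachable u w := by
  rcases le_max_iff.1 hr with h | h
  · by_cases hvw : v = w
    · exact hvw ▸ huv.reachable
    refine huv.reachable.trans (SimpleGraph.Adj.reachable ⟨hvw, ?_⟩)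
    refine hdist_le_of_le (hx v).1 (hx v).2 (hx w).1 h ?_ huv.symm.2
    rw [hb.cos_sub ha, hb.cos_sub hc]
    rw [abs_sub_comm a b] at hab hbc
    exact cos_le_cos_of_abs_le hbc hab
  · by_cases huw : u = w
    · exact huw ▸ SimpleGraph.Reachable.refl u
    refine SimpleGraph.Adj.reachable ⟨huw, ?_⟩
    refine hdist_le_of_le (hx u).1 (hx u).2 (hx w).1 h ?_ huv.2
    rw [ha.cos_sub hb, ha.cos_sub hc]
    exact cos_le_cos_of_abs_le hac hab

theorem reachable_of_central (hx : ∀ v, 0 ≤ (x v).1 ∧ (x v).1 ≤ R) {u v : Fin n}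
    (hu : (x u).1 ≤ R / 2) (hv : (x v).1 ≤ R / 2) : (graph R x).Reachable u v := by
  by_cases h : u = v
  · exact h ▸ SimpleGraph.Reachable.refl u
  · exact SimpleGraph.Adj.reachable
      ⟨h, hdist_le_of_add_le (hx u).1 (hx v).1 (by linarith)⟩

/-- `u` is connected to the center. -/
def Central (R : ℝ) (x : Fin n → ℝ × ℝ) (u : Fin n) : Prop :=
  ∃ z, (graph R x).Reachable u z ∧ (x z).1 ≤ R / 2

theorem Central.of_reachable {u v : Fin n} (h : Central R x v)
    (huv : (graph R x).Reachable u v) : Central R x u :=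
  let ⟨z, hz, hr⟩ := h
  ⟨z, huv.trans hz, hr⟩

/-- An edge that passes over the angle of a vertex connected to the center is itself connected
to the center. -/
theorem central_of_between (hx : ∀ v, 0 ≤ (x v).1 ∧ (x v).1 ≤ R) {u v w : Fin n} {a b c : ℝ}
    (ha : IsLift (x u).2 a) (hb : IsLift (x v).2 b) (hc : IsLift (x w).2 c)
    (hac : a ≤ c) (hcb : c ≤ b) (hab : b - a ≤ π)
    (huv : (graph R x).Adj u v) (hw : Central R x w) : Central R x u := by
  obtain ⟨z, ⟨p⟩, hz⟩ := hw
  have between : ∀ {w : Fin n} {c : ℝ}, IsLift (x w).2 c → a ≤ c → c ≤ b →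
      (x w).1 ≤ max (x u).1 (x v).1 → (graph R x).Reachable u w := by
    intro w c hc hac hcb hr
    refine reachable_of_between hx ha hb hc ?_ ?_ ?_ huv hr
    · rw [abs_sub_comm a c, abs_sub_comm a b, abs_of_nonneg (by linarith),
        abs_of_nonneg (by linarith)]; linarith
    · rw [abs_sub_comm a b, abs_of_nonneg (by linarith), abs_of_nonneg (by linarith)]; linarith
    · rw [abs_sub_comm, abs_of_nonneg (by linarith)]; exact hab
  -- Follow the walk from `w` to the center. As long as it stays over the edge `uv` and further out
  -- than both ends, nothing is known; as soon as one of these fails, the walk connects to `u` or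
  -- `v`.
  induction p generalizing c with
  | nil =>
    rename_i w
    by_cases hr : (x w).1 ≤ max (x u).1 (x v).1
    · exact ⟨w, between hc hac hcb hr, hz⟩
    -- The walk ended over the edge, further out than `u`, yet within R/2; so `u` is itself within
    -- R/2.
    · exact ⟨u, .refl u, ((le_max_left _ _).trans (not_le.1 hr).le).trans hz⟩
  | cons h p ih =>
    rename_i w w' z
    by_cases hr : (x w).1 ≤ max (x u).1 (x v).1
    · exact ⟨z, (between hc hac hcb hr).trans ⟨SimpleGraph.Walk.cons h p⟩, hz⟩
    have hr' := not_le.1 hr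
    obtain ⟨c', hc', hcc'⟩ := IsLift.exists_near (ψ := (x w').2) c
    obtain ⟨h1, h2⟩ := abs_le.1 hcc'
    by_cases hac' : a ≤ c'
    · by_cases hcb' : c' ≤ b
      · exact ih hc' hac' hcb' hz
      -- The edge from `w` to `w'` now passes over `v`, which is less far out than `w`.
      · have hwv : (graph R x).Reachable w v := by
          refine reachable_of_between hx hc hc' hb ?_ ?_ hcc' h ?_
          · rw [abs_sub_comm c b, abs_sub_comm c c', abs_of_nonneg (by linarith),
              abs_of_nonneg (by linarith)]; linarith
          · rw [abs_sub_comm c c', abs_of_nonneg (by linarith),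
              abs_of_nonneg (by linarith)]; linarith
          · exact le_max_of_le_left ((le_max_right _ _).trans hr'.le)
        exact ⟨z, (huv.reachable.trans hwv.symm).trans ⟨SimpleGraph.Walk.cons h p⟩, hz⟩
    · have hwu : (graph R x).Reachable w u := by
        refine reachable_of_between hx hc hc' ha ?_ ?_ hcc' h ?_
        · rw [abs_of_nonneg (by linarith), abs_of_nonneg (by linarith)]; linarith
        · rw [abs_sub_comm c' a, abs_of_nonneg (by linarith),
            abs_of_nonneg (by linarith)]; linarith
        · exact le_max_of_le_left ((le_max_left _ _).trans hr'.le)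
      exact ⟨z, hwu.symm.trans ⟨SimpleGraph.Walk.cons h p⟩, hz⟩

/-- A component that is not connected to the center stays between any two vertices connected
to the center that surround one of its vertices. -/
theorem exists_lift_mem_Icc (hx : ∀ v, 0 ≤ (x v).1 ∧ (x v).1 ≤ R) {w₁ w₂ u v : Fin n}
    {b₁ b₂ a : ℝ} (hb₁ : IsLift (x w₁).2 b₁) (hb₂ : IsLift (x w₂).2 b₂)
    (hw₁ : Central R x w₁) (hw₂ : Central R x w₂) (ha : IsLift (x u).2 a)
    (h₁ : b₁ ≤ a) (h₂ : a ≤ b₂) (hu : ¬ Central R x u) (huv : (graph R x).Reachable u v) :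
    ∃ a', IsLift (x v).2 a' ∧ b₁ ≤ a' ∧ a' ≤ b₂ := by
  obtain ⟨p⟩ := huv
  induction p generalizing a with
  | nil => exact ⟨a, ha, h₁, h₂⟩
  | cons h p ih =>
    rename_i u u' v
    obtain ⟨a', ha', haa'⟩ := IsLift.exists_near (ψ := (x u').2) a
    obtain ⟨h3, h4⟩ := abs_le.1 haa'
    have hu' : ¬ Central R x u' := fun hc => hu (hc.of_reachable h.reachable)
    -- A step out of the interval would be an edge over `w₁` or `w₂`, making the component central.
    refine ih ha' ?_ ?_ hu'
    · by_contra hlt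
      exact hu' (central_of_between hx ha' ha hb₁ (not_le.1 hlt).le h₁ (by linarith) h.symm hw₁)
    · by_contra hlt
      exact hu (central_of_between hx ha ha' hb₂ h₂ (not_le.1 hlt).le (by linarith) h hw₂)

end Graph

/-! ### Sectors of lifted angles -/

theorem sectorIndex_lt {N : ℕ} (hN : 0 < N) {p : ℝ × ℝ} (h2 : p.2 < 2 * π) :
    sectorIndex N p < N := by
  have hN' : (0 : ℝ) < N := by exact_mod_cast hN
  unfold sectorIndex
  rw [Nat.floor_lt' hN.ne', div_lt_iff₀ two_pi_pos]
  exact mul_lt_mul_of_pos_left h2 hN'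

theorem sectorIndex_cast {N : ℕ} {p : ℝ × ℝ} (h0 : 0 ≤ p.2) :
    (sectorIndex N p : ℤ) = ⌊N * p.2 / (2 * π)⌋ := by
  unfold sectorIndex
  exact Int.natCast_floor_eq_floor (by positivity)

theorem sectorIndex_bounds {N : ℕ} (hN : 0 < N) {p : ℝ × ℝ} (h0 : 0 ≤ p.2) :
    sectorIndex N p * (2 * π / N) ≤ p.2 ∧ p.2 < (sectorIndex N p + 1) * (2 * π / N) := by
  have hN' : (0 : ℝ) < N := by exact_mod_cast hN
  have hpi := two_pi_pos
  have h1 := Nat.floor_le (a := N * p.2 / (2 * π)) (by positivity)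
  have h2 := Nat.lt_floor_add_one (N * p.2 / (2 * π))
  rw [le_div_iff₀ hpi] at h1
  rw [div_lt_iff₀ hpi] at h2
  unfold sectorIndex
  constructor
  · rw [← mul_div_assoc, div_le_iff₀ hN']; linarith
  · rw [← mul_div_assoc, lt_div_iff₀ hN']; linarith

theorem IsLift.sectorIndex_eq {N : ℕ} (hN : 0 < N) {p : ℝ × ℝ} (h0 : 0 ≤ p.2)
    (h2 : p.2 < 2 * π) {a : ℝ} (ha : IsLift p.2 a) :
    (sectorIndex N p : ℤ) = ⌊N * a / (2 * π)⌋ % N := by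
  obtain ⟨k, rfl⟩ := ha
  have hpi := two_pi_pos
  have h : N * (p.2 + k * (2 * π)) / (2 * π) = N * p.2 / (2 * π) + ((N * k : ℤ) : ℝ) := by
    push_cast; field_simp
  rw [h, Int.floor_add_intCast, ← sectorIndex_cast h0, Int.add_mul_emod_self_left,
    Int.emod_eq_of_lt (by positivity) (by exact_mod_cast sectorIndex_lt hN h2)]

theorem sectorSpan_le {n : ℕ} (hn : 0 < n) {x : Fin n → ℝ × ℝ} {S : Set (Fin n)}
    (hx : ∀ v, 0 ≤ (x v).2 ∧ (x v).2 < 2 * π) {A B : ℝ}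
    (hS : ∀ v ∈ S, ∃ a, IsLift (x v).2 a ∧ A ≤ a ∧ a ≤ B) (hAB : A ≤ B) :
    (sectorSpan x S : ℝ) ≤ n * (B - A) / (2 * π) + 2 := by
  have hpi := two_pi_pos
  have hn' : (0 : ℝ) < n := by exact_mod_cast hn
  have hpos : 0 ≤ n * (B - A) / (2 * π) := by
    have := sub_nonneg.2 hAB
    positivity
  -- The run starts at the sector of `A`; the 2 pays for the partial sectors at both ends.
  have key : sectorSpan x S ≤ ⌊n * (B - A) / (2 * π)⌋₊ + 2 := by
    refine Nat.sInf_le ⟨(⌊n * A / (2 * π)⌋ % n).toNat, fun v hv => ?_⟩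
    obtain ⟨a, ha, hAa, haB⟩ := hS v hv
    have hle : ⌊n * A / (2 * π)⌋ ≤ ⌊n * a / (2 * π)⌋ := Int.floor_mono (by gcongr)
    obtain ⟨j, hj⟩ := Int.eq_ofNat_of_zero_le (sub_nonneg.2 hle)
    refine ⟨j, ?_, ?_⟩
    · have h1 := Int.floor_le (n * a / (2 * π))
      have h2 := Int.lt_floor_add_one (n * A / (2 * π))
      have h3 := Nat.lt_floor_add_one (n * (B - A) / (2 * π))
      have h4 : n * a / (2 * π) ≤ n * B / (2 * π) := by gcongr
      have h5 : n * (B - A) / (2 * π) = n * B / (2 * π) - n * A / (2 * π) := by ring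
      have h6 : (⌊n * a / (2 * π)⌋ : ℝ) - ⌊n * A / (2 * π)⌋ = j := by exact_mod_cast hj
      have h7 : (j : ℝ) < (⌊n * (B - A) / (2 * π)⌋₊ + 2 : ℕ) := by push_cast; linarith
      exact_mod_cast h7
    · have h1 := ha.sectorIndex_eq hn (hx v).1 (hx v).2
      have h2 : 0 ≤ ⌊n * A / (2 * π)⌋ % (n : ℤ) := Int.emod_nonneg _ (by omega)
      zify
      rw [h1, Int.toNat_of_nonneg h2, Int.emod_add_emod]
      congr 1
      omega
  have h := Nat.floor_le hpos
  have : (sectorSpan x S : ℝ) ≤ (⌊n * (B - A) / (2 * π)⌋₊ + 2 : ℕ) := by exact_mod_cast key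
  push_cast at this
  linarith

/-! ### Ladders to the center -/

section Graph

variable {n : ℕ} {R : ℝ} {x : Fin n → ℝ × ℝ}

/-- All points have polar coordinates in `[0, R] × [0, 2π)`. -/
def InDisc (R : ℝ) (x : Fin n → ℝ × ℝ) : Prop :=
  ∀ v, (0 ≤ (x v).1 ∧ (x v).1 ≤ R) ∧ 0 ≤ (x v).2 ∧ (x v).2 < 2 * π

/-- Each of `N` equal sectors contains a point of depth at least `t`. -/
def Covered (R t : ℝ) (N : ℕ) (x : Fin n → ℝ × ℝ) : Prop :=
  ∀ j < N, ∃ v, (x v).1 ≤ R - t ∧ sectorIndex N (x v) = j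

/-- Induction downwards from level `m₁`, where depth already forces radius at most R/2. The shift by
1 in `hθ` makes the width of a level-(m+1) sector match the angle allowed between depths m and m +
1. -/
theorem central_of_depth (hR : 2 ≤ R) (hx : InDisc R x) {N : ℕ → ℕ} {m₀ m₁ : ℕ} (hm₀ : 1 ≤ m₀)
    (hm₁ : R / 2 ≤ m₁) (hN : ∀ m, m₀ ≤ m → 0 < N m)
    (hθ : ∀ m : ℕ, m₀ ≤ m → 2 * π / N m ≤ exp (m - 1 - R / 2))
    (hcov : ∀ m, m₀ ≤ m → m ≤ m₁ → Covered R m (N m) x) {m : ℕ} (hm : m₀ ≤ m) (hmm₁ : m ≤ m₁)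
    {w : Fin n} (hw : (x w).1 ≤ R - m) : Central R x w := by
  obtain ⟨d, rfl⟩ := Nat.exists_eq_add_of_le hmm₁
  induction d generalizing m w with
  | zero => exact ⟨w, .refl w, by simp at hm₁; linarith⟩
  | succ d ih =>
    have hN' := hN (m + 1) (by omega)
    obtain ⟨v, hv, hvj⟩ := hcov (m + 1) (by omega) (by omega) _
      (sectorIndex_lt hN' (hx w).2.2)
    have hc : Central R x v := by
      refine ih (m := m + 1) (by omega) hv ?_ ?_ (by omega)
      · convert hm₁ using 2; omega
      · intro k h1 h2; exact hcov k h1 (by omega)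
    by_cases hwv : w = v
    · exact hwv ▸ hc
    refine hc.of_reachable (SimpleGraph.Adj.reachable ⟨hwv, ?_⟩)
    refine hdist_le_of_depth (t := m) hR (by exact_mod_cast hm₀.trans hm) (hx w).1.1 (hx v).1.1
      hw (by exact_mod_cast hv) ?_
    have h1 := sectorIndex_bounds hN' (hx w).2.1
    have h2 := sectorIndex_bounds hN' (hx v).2.1
    rw [hvj] at h2
    have h3 := hθ (m + 1) (by omega)
    rw [show ((m + 1 : ℕ) : ℝ) - 1 - R / 2 = m - R / 2 by push_cast; ring] at h3
    rw [abs_le]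
    constructor <;> linarith

theorem Covered.exists_lift {t : ℝ} {N : ℕ} (hN : 0 < N) (hx : InDisc R x)
    (hcov : Covered R t N x) (i : ℤ) : ∃ w b, (x w).1 ≤ R - t ∧ IsLift (x w).2 b ∧
      i * (2 * π / N) ≤ b ∧ b ≤ (i + 1) * (2 * π / N) := by
  have hN' : (0 : ℝ) < N := by exact_mod_cast hN
  have h0 : 0 ≤ i % (N : ℤ) := Int.emod_nonneg _ (by omega)
  have h1 : i % (N : ℤ) < N := Int.emod_lt_of_pos _ (by omega)
  obtain ⟨w, hw, hwj⟩ := hcov (i % (N : ℤ)).toNat (by omega)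
  refine ⟨w, (x w).2 + (i / (N : ℤ) : ℤ) * (2 * π), hw, ⟨_, rfl⟩, ?_⟩
  have h2 := sectorIndex_bounds hN (hx w).2.1
  have h3 : (sectorIndex N (x w) : ℝ) = i - N * (i / (N : ℤ) : ℤ) := by
    have : (sectorIndex N (x w) : ℤ) = i - N * (i / (N : ℤ)) := by
      rw [hwj, Int.toNat_of_nonneg h0, Int.emod_def]
    exact_mod_cast this
  rw [h3] at h2
  have h4 : (i / (N : ℤ) : ℤ) * (2 * π) = N * (i / (N : ℤ) : ℤ) * (2 * π / N) := by
    field_simp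
  rw [h4]
  constructor <;> linarith

/-- The sectors just before and just after that of `u` contain central vertices, and these fence the
component in. -/
theorem exists_lift_of_not_central {t : ℝ} {N : ℕ} (hN : 0 < N) (hx : InDisc R x)
    (hcov : Covered R t N x) (hcen : ∀ w, (x w).1 ≤ R - t → Central R x w) {u v : Fin n}
    (hu : ¬ Central R x u) (huv : (graph R x).Reachable u v) :
    ∃ a, IsLift (x v).2 a ∧ (sectorIndex N (x u) - 1 : ℝ) * (2 * π / N) ≤ a ∧
      a ≤ (sectorIndex N (x u) + 2 : ℝ) * (2 * π / N) := by
  obtain ⟨w₁, b₁, hw₁, hb₁, h1, h2⟩ := hcov.exists_lift hN hx ((sectorIndex N (x u) : ℤ) - 1)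
  obtain ⟨w₂, b₂, hw₂, hb₂, h3, h4⟩ := hcov.exists_lift hN hx ((sectorIndex N (x u) : ℤ) + 1)
  have h5 := sectorIndex_bounds hN (hx u).2.1
  push_cast at h1 h2 h3 h4
  obtain ⟨a, ha, h6, h7⟩ := exists_lift_mem_Icc (fun v => (hx v).1) hb₁ hb₂ (hcen _ hw₁)
    (hcen _ hw₂) (IsLift.self _) (by linarith) (by linarith) hu huv
  exact ⟨a, ha, by linarith, by linarith⟩

theorem not_central_of_component {c : (graph R x).ConnectedComponent}
    (hc : ¬ ∃ v ∈ c.supp, (x v).1 ≤ R / 2) {u : Fin n} (hu : u ∈ c.supp) : ¬ Central R x u :=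
  fun ⟨z, hz, hr⟩ => hc ⟨z, by
    rw [SimpleGraph.ConnectedComponent.mem_supp_iff] at hu ⊢
    rw [← hu, SimpleGraph.ConnectedComponent.eq]; exact hz.symm, hr⟩

theorem sectorSpan_component_le {t : ℝ} {N : ℕ} (hN : 0 < N) (hx : InDisc R x)
    (hcov : Covered R t N x) (hcen : ∀ w, (x w).1 ≤ R - t → Central R x w)
    {c : (graph R x).ConnectedComponent} (hc : ¬ ∃ v ∈ c.supp, (x v).1 ≤ R / 2) :
    (sectorSpan x c.supp : ℝ) ≤ 3 * n / N + 2 := by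
  have hN' : (0 : ℝ) < N := by exact_mod_cast hN
  obtain ⟨u, hu⟩ := c.nonempty_supp
  have h := sectorSpan_le (S := c.supp) u.pos (fun v => (hx v).2)
    (fun v hv => exists_lift_of_not_central hN hx hcov hcen (not_central_of_component hc hu)
      (SimpleGraph.ConnectedComponent.exact (Eq.trans hu (Eq.symm hv))))
    (by gcongr; linarith)
  refine h.trans_eq ?_
  field_simp
  ring

/-- Four sectors rather than three: the window is closed on the right, so its end point may lie in
sector `j + 2`. -/
theorem card_component_le {t : ℝ} {N T : ℕ} (hN : 0 < N) (hx : InDisc R x)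
    (hcov : Covered R t N x) (hcen : ∀ w, (x w).1 ≤ R - t → Central R x w)
    (hT : ∀ j < N, {v | sectorIndex N (x v) = j}.ncard ≤ T)
    {c : (graph R x).ConnectedComponent} (hc : ¬ ∃ v ∈ c.supp, (x v).1 ≤ R / 2) :
    c.supp.ncard ≤ 4 * T := by
  have hN' : (0 : ℝ) < N := by exact_mod_cast hN
  have hpi := two_pi_pos
  obtain ⟨u, hu⟩ := c.nonempty_supp
  set j : ℤ := (sectorIndex N (x u) : ℤ) with hj
  let bin : ℤ → Set (Fin n) := fun i => {v | sectorIndex N (x v) = (i % (N : ℤ)).toNat}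
  have hbin : ∀ i, (bin i).ncard ≤ T := fun i => by
    have h0 : 0 ≤ i % (N : ℤ) := Int.emod_nonneg _ (by omega)
    have h1 : i % (N : ℤ) < N := Int.emod_lt_of_pos _ (by omega)
    exact hT _ (by omega)
  have hsub : c.supp ⊆ (bin (j - 1) ∪ bin j) ∪ (bin (j + 1) ∪ bin (j + 2)) := by
    intro v hv
    obtain ⟨a, ha, h1, h2⟩ := exists_lift_of_not_central hN hx hcov hcen
      (not_central_of_component hc hu)
      (SimpleGraph.ConnectedComponent.exact (Eq.trans hu (Eq.symm hv)))
    have h3 := ha.sectorIndex_eq hN (hx v).2.1 (hx v).2.2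
    have hmem : ∀ i, ⌊N * a / (2 * π)⌋ = i → v ∈ bin i := by
      rintro i rfl
      show _ = _
      rw [← h3]; simp
    have h4 : j - 1 ≤ ⌊N * a / (2 * π)⌋ := by
      rw [Int.le_floor, le_div_iff₀ hpi]
      rw [← mul_div_assoc, div_le_iff₀ hN'] at h1
      push_cast [hj]; linarith
    have h5 : ⌊N * a / (2 * π)⌋ < j + 3 := by
      rw [Int.floor_lt, div_lt_iff₀ hpi]
      rw [← mul_div_assoc, le_div_iff₀ hN'] at h2
      push_cast [hj]; linarith
    have h6 : ⌊N * a / (2 * π)⌋ = j - 1 ∨ ⌊N * a / (2 * π)⌋ = j ∨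
      ⌊N * a / (2 * π)⌋ = j + 1 ∨ ⌊N * a / (2 * π)⌋ = j + 2 := by omega
    rcases h6 with h | h | h | h
    · exact Or.inl (Or.inl (hmem _ h))
    · exact Or.inl (Or.inr (hmem _ h))
    · exact Or.inr (Or.inl (hmem _ h))
    · exact Or.inr (Or.inr (hmem _ h))
  have h1 := Set.ncard_le_ncard hsub (Set.toFinite _)
  have h2 := Set.ncard_union_le (bin (j - 1) ∪ bin j) (bin (j + 1) ∪ bin (j + 2))
  have h3 := Set.ncard_union_le (bin (j - 1)) (bin j)
  have h4 := Set.ncard_union_le (bin (j + 1)) (bin (j + 2))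
  have := hbin (j - 1)
  have := hbin j
  have := hbin (j + 1)
  have := hbin (j + 2)
  omega

theorem secondLargest_le {t : ℝ} {N T : ℕ} (hN : 0 < N) (hx : InDisc R x)
    (hcov : Covered R t N x) (hcen : ∀ w, (x w).1 ≤ R - t → Central R x w)
    (hT : ∀ j < N, {v | sectorIndex N (x v) = j}.ncard ≤ T) :
    secondLargest (graph R x) ≤ 4 * T := by
  unfold secondLargest
  refine Finset.sup_le fun p hp => ?_
  rw [Finset.mem_offDiag] at hp
  by_cases h1 : ∃ v ∈ p.1.supp, (x v).1 ≤ R / 2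
  · by_cases h2 : ∃ v ∈ p.2.supp, (x v).1 ≤ R / 2
    · obtain ⟨u, hu, hur⟩ := h1
      obtain ⟨v, hv, hvr⟩ := h2
      refine absurd ?_ hp.2.2
      rw [SimpleGraph.ConnectedComponent.mem_supp_iff] at hu hv
      rw [← hu, ← hv, SimpleGraph.ConnectedComponent.eq]
      exact reachable_of_central (fun v => (hx v).1) hur hvr
    · exact (min_le_right _ _).trans (card_component_le hN hx hcov hcen hT h2)
  · exact (min_le_left _ _).trans (card_component_le hN hx hcov hcen hT h1)

end Graph

/-! ### The law of a point -/

theorem cosh_sub_one_pos {t : ℝ} (ht : 0 < t) : 0 < cosh t - 1 :=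
  sub_pos.2 (one_lt_cosh.2 ht.ne')

theorem radialLaw_Icc {α R r : ℝ} (hα : 0 < α) (hR : 0 < R) (hr : 0 ≤ r) (hrR : r ≤ R) :
    radialLaw α R (Set.Icc 0 r) =
      ENNReal.ofReal ((cosh (α * r) - 1) / (cosh (α * R) - 1)) := by
  have hc := cosh_sub_one_pos (mul_pos hα hR)
  unfold radialLaw
  rw [withDensity_apply _ measurableSet_Icc, Measure.restrict_restrict measurableSet_Icc,
    Set.inter_eq_left.2 (Set.Icc_subset_Icc_right hrR)]
  have hcont : Continuous fun r : ℝ => α * sinh (α * r) / (cosh (α * R) - 1) := by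
    fun_prop
  rw [← ofReal_integral_eq_lintegral_ofReal]
  · congr 1
    rw [integral_Icc_eq_integral_Ioc, ← intervalIntegral.integral_of_le hr,
      intervalIntegral.integral_eq_sub_of_hasDerivAt
        (f := fun r => cosh (α * r) / (cosh (α * R) - 1))]
    · simp; ring
    · intro t _
      have h := ((hasDerivAt_id t).const_mul α).cosh.div_const (cosh (α * R) - 1)
      simp only [id, mul_one] at h
      convert! h using 1
      ring
    · exact hcont.intervalIntegrable _ _
  · exact hcont.continuousOn.integrableOn_compact isCompact_Icc
  · refine (ae_restrict_mem measurableSet_Icc).mono fun t ht => ?_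
    have := sinh_nonneg_iff.2 (mul_nonneg hα.le ht.1)
    show 0 ≤ _
    positivity

theorem radialLaw_ae_mem (α R : ℝ) : ∀ᵐ r ∂radialLaw α R, r ∈ Set.Icc 0 R :=
  (withDensity_absolutelyContinuous _ _).ae_le (ae_restrict_mem measurableSet_Icc)

theorem isProbabilityMeasure_radialLaw {α R : ℝ} (hα : 0 < α) (hR : 0 < R) :
    IsProbabilityMeasure (radialLaw α R) := by
  have h := radialLaw_Icc hα hR hR.le le_rfl
  rw [div_self (cosh_sub_one_pos (mul_pos hα hR)).ne', ENNReal.ofReal_one] at h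
  exact ⟨by rw [← h]; exact (measure_eq_measure_of_null_sdiff (Set.subset_univ _) (by
    rw [← Set.compl_eq_univ_sdiff]; exact radialLaw_ae_mem α R)).symm⟩

instance : IsProbabilityMeasure angularLaw :=
  ProbabilityTheory.cond_isProbabilityMeasure_of_finite
    (by rw [volume_Ico]; simp [pi_pos]) (by rw [volume_Ico]; exact ENNReal.ofReal_ne_top)

theorem angularLaw_ae_mem : ∀ᵐ φ ∂angularLaw, φ ∈ Set.Ico 0 (2 * π) :=
  ProbabilityTheory.ae_cond_mem measurableSet_Ico

/-- The `j`-th of `N` equal intervals of angles. -/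
def angleInterval (N j : ℕ) : Set ℝ := Set.Ico (j * (2 * π / N)) ((j + 1) * (2 * π / N))

theorem mem_angleInterval {N : ℕ} (hN : 0 < N) {p : ℝ × ℝ} (h0 : 0 ≤ p.2) :
    p.2 ∈ angleInterval N (sectorIndex N p) := sectorIndex_bounds hN h0

theorem sectorIndex_of_mem {N j : ℕ} (hN : 0 < N) {p : ℝ × ℝ} (hp : p.2 ∈ angleInterval N j) :
    sectorIndex N p = j := by
  have hN' : (0 : ℝ) < N := by exact_mod_cast hN
  have hpi := two_pi_pos
  obtain ⟨h1, h2⟩ := hp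
  have h0 : 0 ≤ p.2 := le_trans (by positivity) h1
  unfold sectorIndex
  rw [Nat.floor_eq_iff (by positivity), le_div_iff₀ hpi, div_lt_iff₀ hpi]
  rw [← mul_div_assoc, div_le_iff₀ hN'] at h1
  rw [← mul_div_assoc, lt_div_iff₀ hN'] at h2
  constructor <;> linarith

theorem angularLaw_angleInterval {N j : ℕ} (hj : j < N) :
    angularLaw (angleInterval N j) = ENNReal.ofReal (1 / N) := by
  have hN' : (0 : ℝ) < N := by exact_mod_cast (Nat.zero_le j).trans_lt hj
  have hpi := two_pi_pos
  have hsub : angleInterval N j ⊆ Set.Ico 0 (2 * π) := by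
    refine Set.Ico_subset_Ico (by positivity) ?_
    have : (j + 1 : ℝ) ≤ N := by exact_mod_cast hj
    rw [← mul_div_assoc, div_le_iff₀ hN']
    nlinarith
  unfold angularLaw
  rw [ProbabilityTheory.cond_apply measurableSet_Ico, Set.inter_eq_right.2 hsub, angleInterval,
    volume_Ico, volume_Ico, sub_zero, ← ENNReal.ofReal_inv_of_pos hpi,
    ← ENNReal.ofReal_mul (by positivity)]
  congr 1
  field_simp
  ring

section PointLaw

variable {α R : ℝ}

theorem isProbabilityMeasure_pointLaw (hα : 0 < α) (hR : 0 < R) :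
    IsProbabilityMeasure (pointLaw α R) := by
  have := isProbabilityMeasure_radialLaw hα hR
  unfold pointLaw
  infer_instance

theorem pointLaw_ae_mem (hα : 0 < α) (hR : 0 < R) :
    ∀ᵐ p ∂pointLaw α R, p ∈ Set.Icc 0 R ×ˢ Set.Ico 0 (2 * π) := by
  have := isProbabilityMeasure_radialLaw hα hR
  have h1 : ∀ᵐ p ∂pointLaw α R, p.1 ∈ Set.Icc 0 R :=
    Measure.quasiMeasurePreserving_fst.ae (radialLaw_ae_mem α R)
  have h2 : ∀ᵐ p ∂pointLaw α R, p.2 ∈ Set.Ico 0 (2 * π) :=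
    Measure.quasiMeasurePreserving_snd.ae angularLaw_ae_mem
  filter_upwards [h1, h2] with p hp1 hp2 using ⟨hp1, hp2⟩

theorem pointLaw_box (hα : 0 < α) (hR : 0 < R) {r : ℝ} (hr : 0 ≤ r) (hrR : r ≤ R) {N j : ℕ}
    (hj : j < N) : (pointLaw α R).real (Set.Icc 0 r ×ˢ angleInterval N j) =
      (cosh (α * r) - 1) / (cosh (α * R) - 1) * (1 / N) := by
  have := isProbabilityMeasure_radialLaw hα hR
  have h1 := cosh_sub_one_pos (mul_pos hα hR)
  have h2 := sub_nonneg.2 (one_le_cosh (α * r))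
  rw [Measure.real, pointLaw, Measure.prod_prod, radialLaw_Icc hα hR hr hrR,
    angularLaw_angleInterval hj, ← ENNReal.ofReal_mul (by positivity),
    ENNReal.toReal_ofReal (by positivity)]

theorem pointLaw_sector (hα : 0 < α) (hR : 0 < R) {N j : ℕ} (hj : j < N) :
    (pointLaw α R).real (Set.univ ×ˢ angleInterval N j) = 1 / N := by
  have := isProbabilityMeasure_radialLaw hα hR
  rw [Measure.real, pointLaw, Measure.prod_prod, measure_univ, one_mul,
    angularLaw_angleInterval hj, ENNReal.toReal_ofReal (by positivity)]

end PointLaw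

/-! ### Independent samples -/

section Sample

variable {E : Type*} [MeasurableSpace E] (μ : Measure E) [IsProbabilityMeasure μ] (n : ℕ)

theorem pi_forall_notMem_le {B : Set E} (hB : MeasurableSet B) :
    (Measure.pi fun _ : Fin n => μ).real {x | ∀ v, x v ∉ B} ≤ exp (-(n * μ.real B)) := by
  have h : {x : Fin n → E | ∀ v, x v ∉ B} = Set.univ.pi fun _ => Bᶜ := by
    ext; simp
  rw [h, Measure.real, Measure.pi_pi, Finset.prod_const, Finset.card_univ, Fintype.card_fin,
    ENNReal.toReal_pow, ← Measure.real, probReal_compl_eq_one_sub hB]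
  calc (1 - μ.real B) ^ n ≤ exp (-μ.real B) ^ n :=
        pow_le_pow_left₀ (sub_nonneg.2 measureReal_le_one)
          (one_sub_le_exp_neg _) n
    _ = _ := by rw [← exp_nat_mul]; congr 1; ring

/-- Exponential Markov inequality with parameter 1. Here `f` is the exponential of the indicator of
`B`, whose mean 1 + (e - 1)μ(B) is at most exp(2μ(B)). -/
theorem pi_le_ncard_le {B : Set E} (hB : MeasurableSet B) (T : ℝ) :
    (Measure.pi fun _ : Fin n => μ).real {x | T ≤ {v | x v ∈ B}.ncard} ≤
      exp (2 * (n * μ.real B) - T) := by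
  classical
  let f : E → ℝ := fun y => 1 + B.indicator (fun _ => exp 1 - 1) y
  have hint : Integrable (B.indicator fun _ => exp 1 - 1) μ :=
    (integrable_const _).indicator hB
  have hf : Integrable f μ := (integrable_const _).add hint
  have hprod : ∀ x : Fin n → E, ∏ v, f (x v) = exp ({v | x v ∈ B}.ncard) := by
    intro x
    have h1 : ∀ v, f (x v) = if x v ∈ B then exp 1 else 1 := fun v => by
      by_cases h : x v ∈ B <;> simp [f, h]
    simp_rw [h1]
    rw [Finset.prod_ite, Finset.prod_const, Finset.prod_const_one, mul_one, ← exp_nat_mul,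
      mul_one, Set.ncard_eq_toFinset_card']
    simp
  have hfint : ∫ y, f y ∂μ ≤ exp (2 * μ.real B) := by
    rw [integral_add (integrable_const _) hint, integral_indicator_const _ hB]
    simp only [integral_const, probReal_univ, smul_eq_mul, mul_one]
    have h3 := exp_one_lt_d9
    have h4 := add_one_le_exp (2 * μ.real B)
    nlinarith [measureReal_nonneg (μ := μ) (s := B)]
  have hfpos : 0 ≤ ∫ y, f y ∂μ := by
    refine integral_nonneg fun y => ?_
    have h2 := exp_one_gt_d9
    by_cases h : y ∈ B
    · simp only [f, h, Set.indicator_of_mem, Pi.zero_apply]; linarith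
    · simp [f, h]
  have hmk := mul_meas_ge_le_integral_of_nonneg (μ := Measure.pi fun _ : Fin n => μ)
    (f := fun x => ∏ v, f (x v))
    (Filter.Eventually.of_forall fun x => (exp_pos _).le.trans_eq (hprod x).symm)
    (Integrable.fintype_prod fun _ => hf) (exp T)
  rw [integral_fintype_prod_eq_pow, Fintype.card_fin] at hmk
  have hset : {x : Fin n → E | exp T ≤ ∏ v, f (x v)} = {x | T ≤ {v | x v ∈ B}.ncard} := by
    ext x; simp only [Set.mem_ofPred_eq, hprod, exp_le_exp]
  rw [hset] at hmk
  have h5 : (∫ y, f y ∂μ) ^ n ≤ exp (2 * (n * μ.real B)) := by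
    refine (pow_le_pow_left₀ hfpos hfint n).trans_eq ?_
    rw [← exp_nat_mul]; congr 1; ring
  rw [exp_sub, le_div_iff₀ (exp_pos T), mul_comm]
  exact hmk.trans h5

theorem pi_ae_forall_mem {D : Set E} (hD : ∀ᵐ y ∂μ, y ∈ D) :
    ∀ᵐ x ∂(Measure.pi fun _ : Fin n => μ), ∀ v, x v ∈ D :=
  ae_all_iff.2 fun v =>
    (measurePreserving_eval (fun _ : Fin n => μ) v).quasiMeasurePreserving.ae hD

end Sample

/-- Subadditivity suffices, so the events of the theorem need not be shown measurable. -/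
theorem one_sub_le_measureReal {E : Type*} [MeasurableSpace E] (μ : Measure E)
    [IsProbabilityMeasure μ] {S : Set E} {ε : ℝ} (h : μ.real Sᶜ ≤ ε) : 1 - ε ≤ μ.real S := by
  have h1 := measureReal_union_le (μ := μ) S Sᶜ
  rw [Set.union_compl_self, probReal_univ] at h1
  linarith

/-! ### The good event -/

theorem isProbabilityMeasure_sampleLaw {n : ℕ} {α C : ℝ} (hα : 0 < α) (hR : 0 < radius n C) :
    IsProbabilityMeasure (sampleLaw n α C) := by
  have := isProbabilityMeasure_pointLaw hα hR
  unfold sampleLaw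
  infer_instance

/-- At every depth `m₀ ≤ m ≤ m₁` each of `N m` equal sectors contains a point of depth at least
`m`, and each of `N m₀` equal sectors contains at most `T` points. -/
structure Good {n : ℕ} (R : ℝ) (N : ℕ → ℕ) (m₀ m₁ T : ℕ) (x : Fin n → ℝ × ℝ) : Prop where
  inDisc : InDisc R x
  covered : ∀ m, m₀ ≤ m → m ≤ m₁ → Covered R m (N m) x
  ncard_le : ∀ j < N m₀, {v | sectorIndex (N m₀) (x v) = j}.ncard ≤ T

theorem sampleLaw_not_good_le {n : ℕ} {α C : ℝ} (hα : 0 < α) (hR : 0 < radius n C)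
    {N : ℕ → ℕ} {m₀ m₁ T : ℕ} {B s : ℝ} (hN : ∀ m, 0 < N m)
    (hNB : ∀ m, m₀ ≤ m → m ≤ m₁ → N m ≤ B) (hm : m₀ ≤ m₁) (hm₁ : m₁ ≤ radius n C)
    (hs : ∀ m : ℕ, m₀ ≤ m → m ≤ m₁ → s ≤ n * ((cosh (α * (radius n C - m)) - 1) /
      (cosh (α * radius n C) - 1) * (1 / N m)))
    (hT : 2 * (n * (1 / N m₀)) + s ≤ T) :
    (sampleLaw n α C).real {x | ¬ Good (radius n C) N m₀ m₁ T x} ≤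
      (m₁ + 2) * B * exp (-s) := by
  classical
  have := isProbabilityMeasure_pointLaw hα hR
  set R := radius n C with hRdef
  set P := pointLaw α R with hP
  have hsample : sampleLaw n α C = Measure.pi fun _ : Fin n => P := rfl
  rw [hsample]
  set Q := Measure.pi fun _ : Fin n => P
  -- The ways to fail: `D`, a point outside the disc (a null event); `E m j`, an empty cell; `F j`,
  -- an overfull sector. Each `E m j` and `F j` has probability at most exp(-s), and each level has
  -- at most `B` sectors.
  let D : Set (Fin n → ℝ × ℝ) := {x | ¬ ∀ v, x v ∈ Set.Icc 0 R ×ˢ Set.Ico 0 (2 * π)}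
  let E : ℕ → ℕ → Set (Fin n → ℝ × ℝ) := fun m j =>
    {x | ∀ v, x v ∉ Set.Icc 0 (R - m) ×ˢ angleInterval (N m) j}
  let F : ℕ → Set (Fin n → ℝ × ℝ) := fun j =>
    {x | (T : ℝ) ≤ {v | x v ∈ Set.univ ×ˢ angleInterval (N m₀) j}.ncard}
  have hsub : {x | ¬ Good R N m₀ m₁ T x} ⊆
      (D ∪ ⋃ m ∈ Finset.Icc m₀ m₁, ⋃ j ∈ Finset.range (N m), E m j) ∪
        ⋃ j ∈ Finset.range (N m₀), F j := by
    intro x hx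
    by_contra hcon
    simp only [Set.mem_union, Set.mem_iUnion, not_or, not_exists, Finset.mem_Icc,
      Finset.mem_range] at hcon
    obtain ⟨⟨h1, h2⟩, h3⟩ := hcon
    have hD : InDisc R x := by
      intro v
      have := not_not.1 h1 v
      exact ⟨this.1, this.2⟩
    refine hx ⟨hD, fun m hm0 hm1 j hj => ?_, fun j hj => ?_⟩
    · have h := h2 m ⟨hm0, hm1⟩ j hj
      simp only [E, Set.mem_ofPred_eq, not_forall, not_not] at h
      obtain ⟨v, hv⟩ := h
      exact ⟨v, hv.1.2, sectorIndex_of_mem (hN m) hv.2⟩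
    · have h := h3 j hj
      simp only [F, Set.mem_ofPred_eq, not_le] at h
      have h' : {v | x v ∈ Set.univ ×ˢ angleInterval (N m₀) j}.ncard < T := by exact_mod_cast h
      refine (Set.ncard_le_ncard ?_ (Set.toFinite _)).trans h'.le
      rintro v rfl
      exact ⟨trivial, mem_angleInterval (hN m₀) (hD v).2.1⟩
  have hmeas : ∀ N j, MeasurableSet (angleInterval N j) := fun _ _ => measurableSet_Ico
  have hD : Q.real D = 0 := by
    rw [Measure.real, (ENNReal.toReal_eq_zero_iff _).2 (Or.inl ?_)]
    exact pi_ae_forall_mem P n (pointLaw_ae_mem hα hR)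
  have hE : ∀ m ∈ Finset.Icc m₀ m₁, Q.real (⋃ j ∈ Finset.range (N m), E m j) ≤
      B * exp (-s) := by
    intro m hm
    rw [Finset.mem_Icc] at hm
    have hmR : (m : ℝ) ≤ R := le_trans (by exact_mod_cast hm.2) hm₁
    refine (measureReal_biUnion_finset_le _ _).trans ?_
    refine (Finset.sum_le_card_nsmul _ _ (exp (-s)) fun j hj => ?_).trans ?_
    · refine (pi_forall_notMem_le P n (measurableSet_Icc.prod (hmeas _ _))).trans ?_
      rw [pointLaw_box hα hR (sub_nonneg.2 hmR) (sub_le_self _ (Nat.cast_nonneg m))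
        (Finset.mem_range.1 hj)]
      exact exp_le_exp.2 (neg_le_neg (hs m hm.1 hm.2))
    · rw [Finset.card_range, nsmul_eq_mul]
      exact mul_le_mul_of_nonneg_right (hNB m hm.1 hm.2) (exp_pos _).le
  have hF : Q.real (⋃ j ∈ Finset.range (N m₀), F j) ≤ B * exp (-s) := by
    refine (measureReal_biUnion_finset_le _ _).trans ?_
    refine (Finset.sum_le_card_nsmul _ _ (exp (-s)) fun j hj => ?_).trans ?_
    · refine (pi_le_ncard_le P n (MeasurableSet.univ.prod (hmeas _ _)) _).trans ?_
      rw [pointLaw_sector hα hR (Finset.mem_range.1 hj)]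
      exact exp_le_exp.2 (by linarith)
    · rw [Finset.card_range, nsmul_eq_mul]
      exact mul_le_mul_of_nonneg_right (hNB m₀ le_rfl hm) (exp_pos _).le
  have hEE : Q.real (⋃ m ∈ Finset.Icc m₀ m₁, ⋃ j ∈ Finset.range (N m), E m j) ≤
      (m₁ + 1) * (B * exp (-s)) := by
    refine (measureReal_biUnion_finset_le _ _).trans ?_
    refine (Finset.sum_le_card_nsmul _ _ _ hE).trans ?_
    have hB : 0 ≤ B := (Nat.cast_nonneg _).trans (hNB m₀ le_rfl hm)
    rw [nsmul_eq_mul]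
    refine mul_le_mul_of_nonneg_right ?_ (by positivity)
    have : (Finset.Icc m₀ m₁).card ≤ m₁ + 1 := by rw [Nat.card_Icc]; omega
    exact_mod_cast this
  have h1 := measureReal_mono (μ := Q) hsub
  have h2 := measureReal_union_le (μ := Q)
    (D ∪ ⋃ m ∈ Finset.Icc m₀ m₁, ⋃ j ∈ Finset.range (N m), E m j)
    (⋃ j ∈ Finset.range (N m₀), F j)
  have h3 := measureReal_union_le (μ := Q) D
    (⋃ m ∈ Finset.Icc m₀ m₁, ⋃ j ∈ Finset.range (N m), E m j)
  linarith

/-! ### Choice of the depths -/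

/-- The hypotheses give α(R - t) ≥ 2, and exp 2 > 4 absorbs the -1 in the numerator at the cost of a
factor 2. -/
theorem cosh_ratio_ge {α R t : ℝ} (hα : 1 / 2 ≤ α) (ht : 4 ≤ R - t) (h0 : 0 ≤ t) :
    exp (-(α * t)) / 2 ≤ (cosh (α * (R - t)) - 1) / (cosh (α * R) - 1) := by
  have hR : 0 < α * R := by apply mul_pos <;> linarith
  rw [le_div_iff₀ (cosh_sub_one_pos hR)]
  have h1 : cosh (α * R) - 1 ≤ exp (α * R) / 2 := by
    rw [cosh_eq]
    have : exp (-(α * R)) ≤ exp 0 := exp_le_exp.2 (by linarith)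
    rw [exp_zero] at this
    linarith
  have h2 : exp (α * (R - t)) / 4 ≤ cosh (α * (R - t)) - 1 := by
    rw [cosh_eq]
    have h3 : exp 2 ≤ exp (α * (R - t)) := exp_le_exp.2 (by nlinarith)
    have h4 : exp 2 = exp 1 * exp 1 := by rw [← exp_add]; norm_num
    have h5 := exp_one_gt_d9
    have h6 := exp_pos (-(α * (R - t)))
    nlinarith
  calc exp (-(α * t)) / 2 * (cosh (α * R) - 1)
      ≤ exp (-(α * t)) / 2 * (exp (α * R) / 2) := by gcongr
    _ = exp (-(α * t)) * exp (α * R) / 4 := by ring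
    _ = exp (α * (R - t)) / 4 := by rw [← exp_add]; congr 2; ring
    _ ≤ _ := h2

theorem eventually_log_bounds (C q k : ℝ) (hq : 0 < q) : ∀ᶠ n : ℕ in Filter.atTop,
    1 ≤ n ∧ 1 ≤ log n ∧ 10 ≤ radius n C ∧ 0 < q * log (log n) + k ∧
      q * log (log n) + k + 1 ≤ radius n C / 2 ∧ radius n C / 2 + 3 ≤ n := by
  have hlog : Filter.Tendsto (fun n : ℕ => log n) Filter.atTop Filter.atTop :=
    tendsto_log_atTop.comp tendsto_natCast_atTop_atTop
  have hloglog := tendsto_log_atTop.comp hlog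
  have small : ∀ c : ℝ, 0 < c → ∀ᶠ y : ℝ in Filter.atTop, log y ≤ c * y := fun c hc => by
    filter_upwards [isLittleO_log_id_atTop.def hc, Filter.eventually_ge_atTop 0] with y hy h0
    rw [norm_eq_abs, norm_eq_abs, id, abs_of_nonneg h0] at hy
    exact (le_abs_self _).trans hy
  filter_upwards [Filter.eventually_ge_atTop 1, hlog.eventually_ge_atTop 1,
    hlog.eventually_ge_atTop (10 + |C|), hlog.eventually_ge_atTop (2 * (|k| + 1 + |C|)),
    hloglog.eventually_ge_atTop ((|k| + 1) / q),
    hlog.eventually (small (1 / (2 * q)) (by positivity)),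
    tendsto_natCast_atTop_atTop.eventually (small (1 / 2) (by norm_num)),
    tendsto_natCast_atTop_atTop.eventually_ge_atTop (2 * (|C| + 3) : ℝ)]
    with n h1 h2 h3 h4 h5 h6 h7 h8
  have hC := neg_abs_le C
  have hC' := le_abs_self C
  have hk := neg_abs_le k
  have hk' := le_abs_self k
  have hk0 := abs_nonneg k
  have hC0 := abs_nonneg C
  simp only [Function.comp_apply, div_le_iff₀ hq] at h5
  have h9 : q * log (log n) ≤ log n / 2 := by
    calc _ ≤ q * (1 / (2 * q) * log n) := by gcongr
      _ = _ := by field_simp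
  unfold radius
  refine ⟨h1, h2, ?_, ?_, ?_, ?_⟩ <;> linarith

set_option maxHeartbeats 800000 in
-- The depth `m₀` is the least integer at least q log log n + k, so that exp((1-α)m₀) is at least a
-- prescribed multiple of log n, while exp(m₀), and with it n / N m₀, stays O((log n)^q).
theorem exists_good {α : ℝ} (hα : 1 / 2 < α) (hα' : α < 1) (C : ℝ) :
    ∃ K > (0 : ℝ), ∃ M > (0 : ℝ), ∀ᶠ n : ℕ in Filter.atTop, 10 ≤ radius n C ∧
      ∃ (N : ℕ → ℕ) (m₀ m₁ T : ℕ), 1 ≤ m₀ ∧ m₀ ≤ m₁ ∧ radius n C / 2 ≤ m₁ ∧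
        (∀ m, 0 < N m) ∧ (∀ m : ℕ, 2 * π / N m ≤ exp (m - 1 - radius n C / 2)) ∧
        3 * n / N m₀ + 2 < K * log n ^ (1 / (1 - α)) ∧
        4 * (T : ℝ) ≤ K * log n ^ (1 / (1 - α)) ∧
        (sampleLaw n α C).real {x | ¬ Good (radius n C) N m₀ m₁ T x} ≤
          M * (n : ℝ) ^ (-(3 / 2) : ℝ) := by
  have hα1 : 0 < 1 - α := by linarith
  set q := 1 / (1 - α) with hq
  have hq1 : 1 ≤ q := by rw [hq, le_div_iff₀ hα1]; linarith
  have hqα : (1 - α) * q = 1 := by rw [hq]; field_simp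
  -- 184 = 4 · 2 · 23: the wanted mean 4 log n, the loss 1/2 in `cosh_ratio_ge`, and the bound N m ≤
  -- 23·exp(R/2 - m).
  set k := (log 184 + C / 2) * q with hk
  set A := exp (k + 1 - C / 2) / 10 with hA
  have hA0 : 0 < A := by positivity
  refine ⟨4 * A + 20, by positivity, 23 * exp (C / 2), by positivity, ?_⟩
  filter_upwards [eventually_log_bounds C q k (by linarith)] with n hn
  obtain ⟨hn1, hlog, hR, hpos, hhalf, hRn⟩ := hn
  refine ⟨hR, ?_⟩
  set R := radius n C with hRdef
  have hn0 : (0 : ℝ) < n := by exact_mod_cast hn1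
  have hexpR : exp (R / 2) = n * exp (C / 2) := by
    rw [hRdef, radius, show (2 * log n + C) / 2 = log n + C / 2 by ring, exp_add, exp_log hn0]
  -- 20 exceeds 2πe, as the sector width requires. Rounding up adds at most e·exp(R/2 - m) for m ≤
  -- m₁, whence 23 below.
  set N : ℕ → ℕ := fun m : ℕ => ⌈20 * exp (R / 2 - m)⌉₊ with hNdef
  set m₀ := ⌈q * log (log n) + k⌉₊ with hm₀
  set m₁ := ⌈R / 2⌉₊ with hm₁
  have hm₀lt : (m₀ : ℝ) < q * log (log n) + k + 1 := Nat.ceil_lt_add_one hpos.le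
  have hm₀ge : q * log (log n) + k ≤ m₀ := Nat.le_ceil _
  have hm₁lt : (m₁ : ℝ) < R / 2 + 1 := Nat.ceil_lt_add_one (by linarith)
  have hm₁ge : R / 2 ≤ m₁ := Nat.le_ceil _
  have hNge : ∀ m : ℕ, 20 * exp (R / 2 - m) ≤ N m := fun m => Nat.le_ceil _
  have hNpos : ∀ m, 0 < N m := fun m => Nat.ceil_pos.2 (by positivity)
  have hNpos' : ∀ m, (0 : ℝ) < N m := fun m => by exact_mod_cast hNpos m
  have hNle : ∀ m, m ≤ m₁ → (N m : ℝ) ≤ 23 * exp (R / 2 - m) := by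
    intro m hm
    have h1 : (N m : ℝ) < 20 * exp (R / 2 - m) + 1 := Nat.ceil_lt_add_one (by positivity)
    have h2 : (m : ℝ) ≤ m₁ := by exact_mod_cast hm
    have h3 : exp (-1) ≤ exp (R / 2 - m) := exp_le_exp.2 (by linarith)
    have h4 : 1 = exp 1 * exp (-1) := by rw [← exp_add]; simp
    nlinarith [exp_one_lt_d9, exp_one_gt_d9, exp_pos (-1)]
  set L := log n ^ q with hL
  have hL1 : log n ≤ L := by
    conv_lhs => rw [← rpow_one (log n)]
    exact rpow_le_rpow_of_exponent_le hlog hq1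
  have hratio : 2 * (n * (1 / N m₀)) ≤ A * L := by
    have h1 : L = exp (q * log (log n)) := by
      rw [hL, rpow_def_of_pos (by linarith), mul_comm]
    have h2 : 2 * (n * (1 / (N m₀ : ℝ))) ≤ 2 * (n * (1 / (20 * exp (R / 2 - m₀)))) := by
      gcongr; exact hNge m₀
    have h3 : 2 * (n * (1 / (20 * exp (R / 2 - m₀)))) = exp (m₀ - C / 2) / 10 := by
      rw [exp_sub, exp_sub, hexpR]; field_simp; norm_num
    rw [h3] at h2
    refine h2.trans ?_
    rw [hA, h1, div_mul_eq_mul_div, ← exp_add]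
    gcongr
    linarith
  set s := 4 * log n with hs
  set T := ⌈A * L + s⌉₊ with hT
  have hTge : A * L + s ≤ T := Nat.le_ceil _
  have hTlt : (T : ℝ) < A * L + s + 1 := Nat.ceil_lt_add_one (by positivity)
  have hm₀₁ : m₀ ≤ m₁ := by
    have : (m₀ : ℝ) ≤ m₁ := by linarith
    exact_mod_cast this
  refine ⟨N, m₀, m₁, T, Nat.ceil_pos.2 hpos, hm₀₁, hm₁ge, hNpos, ?_, ?_, ?_, ?_⟩
  · intro m
    rw [div_le_iff₀ (hNpos' m)]
    have h1 : exp (m - 1 - R / 2) * (20 * exp (R / 2 - m)) = 20 * exp (-1) := by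
      rw [mul_left_comm, ← exp_add]; congr 2; ring
    have h2 := mul_le_mul_of_nonneg_left (hNge m) (exp_pos (m - 1 - R / 2)).le
    have h4 : 1 = exp 1 * exp (-1) := by rw [← exp_add]; simp
    nlinarith [exp_one_lt_d9, pi_lt_d2, exp_pos (-1)]
  · have : 3 * n / (N m₀ : ℝ) = 3 / 2 * (2 * (n * (1 / N m₀))) := by ring
    rw [this]
    nlinarith
  · nlinarith
  · have hbound : ∀ m : ℕ, m₀ ≤ m → m ≤ m₁ → s ≤ n * ((cosh (α * (R - m)) - 1) /
        (cosh (α * R) - 1) * (1 / N m)) := by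
      intro m hm0 hm1
      have h1 : (m : ℝ) ≤ m₁ := by exact_mod_cast hm1
      have h0 : (m₀ : ℝ) ≤ m := by exact_mod_cast hm0
      have h2 := cosh_ratio_ge (R := R) (t := m) hα.le (by linarith) (Nat.cast_nonneg m)
      calc s = exp ((1 - α) * (q * log (log n) + k)) * exp (-(C / 2)) / 46 := by
            have h3 : (1 - α) * (q * log (log n) + k) =
                log (log n) + (log 184 + C / 2) := by
              rw [hk]; linear_combination (log (log n) + (log 184 + C / 2)) * hqα
            rw [h3, exp_add, exp_add, exp_log (by linarith), exp_log (by norm_num), exp_neg, hs]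
            field_simp; norm_num
        _ ≤ exp ((1 - α) * m) * exp (-(C / 2)) / 46 := by
            gcongr; linarith
        _ = n * (exp (-(α * m)) / 2 * (1 / (23 * exp (R / 2 - m)))) := by
            rw [exp_sub, hexpR, exp_neg, exp_neg, show (1 - α) * m = m - α * m by ring, exp_sub]
            field_simp; norm_num
        _ ≤ _ := by
            exact mul_le_mul_of_nonneg_left (mul_le_mul h2
              (one_div_le_one_div_of_le (hNpos' m) (hNle m hm1)) (by positivity)
              (le_trans (by positivity) h2)) hn0.le
    have h := sampleLaw_not_good_le (by linarith : 0 < α) (by linarith : 0 < R) hNpos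
      (B := 23 * exp (C / 2) * n) (fun m h0 h1 => (hNle m h1).trans ?_) hm₀₁ (by linarith)
      hbound (T := T) (by linarith)
    · refine h.trans ?_
      have h1 : exp (-s) = (n : ℝ) ^ (-4 : ℝ) := by
        rw [rpow_def_of_pos hn0]; congr 1; rw [hs]; ring
      -- One factor n bounds `m₁ + 2`, the other comes from the number of sectors; the failure
      -- probability is in fact O(n^(-2)).
      have h2 : (n : ℝ) ^ (-(3 / 2) : ℝ) ≥ n * n * (n : ℝ) ^ (-4 : ℝ) := by
        have h3 : (n : ℝ) * n * (n : ℝ) ^ (-4 : ℝ) = (n : ℝ) ^ (-2 : ℝ) := by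
          rw [show (-2 : ℝ) = 1 + 1 + -4 by norm_num, rpow_add hn0, rpow_add hn0, rpow_one]
        rw [h3]
        exact rpow_le_rpow_of_exponent_le (by exact_mod_cast hn1) (by norm_num)
      rw [h1]
      calc (m₁ + 2) * (23 * exp (C / 2) * n) * (n : ℝ) ^ (-4 : ℝ)
          ≤ n * (23 * exp (C / 2) * n) * (n : ℝ) ^ (-4 : ℝ) := by
            gcongr; linarith
        _ = 23 * exp (C / 2) * (n * n * (n : ℝ) ^ (-4 : ℝ)) := by ring
        _ ≤ _ := by gcongr
    · have : exp (R / 2 - m) ≤ exp (R / 2) := exp_le_exp.2 (by simp)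
      rw [hexpR] at this
      linarith

end HyperbolicRandomGraph

end

theorem corollary2 (β α C : ℝ) (hβ₂ : 2 < β) (hβ₃ : β < 3) (hα : β = 2 * α + 1) :
    (∃ K > (0 : ℝ), ∃ M > (0 : ℝ), ∀ᶠ n : ℕ in Filter.atTop,
      1 - M * (n : ℝ) ^ (-(3 / 2) : ℝ) ≤
        (HyperbolicRandomGraph.sampleLaw n α C).real
          {x | (HyperbolicRandomGraph.secondLargest
              (HyperbolicRandomGraph.graph (HyperbolicRandomGraph.radius n C) x) : ℝ)
            ≤ K * Real.log n ^ (2 / (3 - β))}) ∧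
    (∃ K > (0 : ℝ), ∃ M > (0 : ℝ), ∀ᶠ n : ℕ in Filter.atTop,
      1 - M * (n : ℝ) ^ (-(3 / 2) : ℝ) ≤
        (HyperbolicRandomGraph.sampleLaw n α C).real
          {x | ∀ c : (HyperbolicRandomGraph.graph
              (HyperbolicRandomGraph.radius n C) x).ConnectedComponent,
            K * Real.log n ^ (1 / (1 - α)) ≤ (HyperbolicRandomGraph.sectorSpan x c.supp : ℝ) →
              ∃ v ∈ c.supp, (x v).1 ≤ HyperbolicRandomGraph.radius n C / 2}) := by
  have hα1 : 1 / 2 < α := by linarith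
  have hα2 : α < 1 := by linarith
  obtain ⟨K, hK, M, hM, hgood⟩ := HyperbolicRandomGraph.exists_good hα1 hα2 C
  have hexp : 2 / (3 - β) = 1 / (1 - α) := by
    rw [hα, div_eq_div_iff (by linarith) (by linarith)]; ring
  rw [hexp]
  refine ⟨⟨K, hK, M, hM, ?_⟩, ⟨K, hK, M, hM, ?_⟩⟩
  · filter_upwards [hgood] with n ⟨hR, N, m₀, m₁, T, h0, h01, h1, hN, hθ, _, hTK, hP⟩
    have := HyperbolicRandomGraph.isProbabilityMeasure_sampleLaw (n := n) (C := C)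
      (by linarith : 0 < α) (by linarith)
    refine HyperbolicRandomGraph.one_sub_le_measureReal _
      ((MeasureTheory.measureReal_mono ?_).trans hP)
    intro x hx hg
    refine hx (le_trans ?_ hTK)
    exact_mod_cast HyperbolicRandomGraph.secondLargest_le (hN m₀) hg.inDisc
      (hg.covered m₀ le_rfl h01)
      (fun w hw => HyperbolicRandomGraph.central_of_depth (by linarith) hg.inDisc h0 h1
        (fun m _ => hN m) (fun m _ => hθ m) hg.covered le_rfl h01 hw) hg.ncard_le
  · filter_upwards [hgood] with n ⟨hR, N, m₀, m₁, T, h0, h01, h1, hN, hθ, hNK, _, hP⟩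
    have := HyperbolicRandomGraph.isProbabilityMeasure_sampleLaw (n := n) (C := C)
      (by linarith : 0 < α) (by linarith)
    refine HyperbolicRandomGraph.one_sub_le_measureReal _
      ((MeasureTheory.measureReal_mono ?_).trans hP)
    intro x hx hg
    refine hx fun c hc => ?_
    by_contra hcon
    have := HyperbolicRandomGraph.sectorSpan_component_le (hN m₀) hg.inDisc
      (hg.covered m₀ le_rfl h01)
      (fun w hw => HyperbolicRandomGraph.central_of_depth (by linarith) hg.inDisc h0 h1
        (fun m _ => hN m) (fun m _ => hθ m) hg.covered le_rfl h01 hw) hcon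
    linarith
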